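/- Let $n$ be a natural number, $S\subseteq\{0,1\}^n$, and let $f:S\to\{0,1\}$ be a (possibly partial) boolean function. For boolean functions $f:S\to\{0,1\}$, $S\subseteq\{0,1\}^n$, and $g:C\to\{0,1\}$, $C\subseteq\{0,1\}^m$, the composition $f\circ(g,\dots,g)$ is the partial boolean function on $\{0,1\}^{nm}$ whose domain consists of all $x=(x^1,\dots,x^n)$ with $x^i\in C$ for every $i$ and $(g(x^1),\dots,g(x^n))\in S$, and whose value at such an $x$ is $f(g(x^1),\dots,g(x^n))$. Put $f^1=f$ and $f^d=f\circ(f^{d-1},\dots,f^{d-1})$ for $d\ge 2$. For a boolean function $h:D\to\{0,1\}$ with $D\subseteq\{0,1\}^m$, the general adversary bound is $$\mathrm{ADV}^{\pm}(h)=\max\bigl\{\|\Gamma\| \;:\; \|\Gamma\circ\Delta_i\|\le 1 \text{ for all } i=1,\dots,m\bigr\},$$ where $\Gamma$ ranges over the real symmetric matrices indexed by $D$ with $\Gamma_{xy}=0$ whenever $h(x)=h(y)$, $\|\cdot\|$ is the spectral norm, $\circ$ between matrices is the entrywise product, and $(\Delta_i)_{xy}=1$ if $x_i\ne y_i$ and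 $0$ otherwise. Then for every integer $d\ge 1$, $$\mathrm{ADV}^{\pm}(f^d)\ \ge\ \bigl(\mathrm{ADV}^{\pm}(f)\bigr)^d .$$ -/

import Mathlib

/-- A (possibly partial) boolean function `f : S → {0,1}` with `S ⊆ {0,1}^ι`, where `ι` is the set
of positions of the input bits. -/
structure PartialBoolFun (ι : Type) where
  /-- The domain `S`. -/
  dom : Set (ι → Bool)
  /-- The values of the function on its domain. -/
  val : dom → Bool

namespace PartialBoolFun

/-- The `i`-th block `xⁱ` of an input `x = (xⁱ)ᵢ` of a composed function. -/
def block {ι κ : Type} (x : ι × κ → Bool) (i : ι) : κ → Bool := fun k => x (i, k)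

/-- The composition `f ∘ (g, …, g)`: an input `x = (xⁱ)ᵢ` is valid if every block `xⁱ` is a valid
input of `g` and the string `(g(xⁱ))ᵢ` is a valid input of `f`; the value is then `f((g(xⁱ))ᵢ)`. -/
def comp {ι κ : Type} (f : PartialBoolFun ι) (g : PartialBoolFun κ) : PartialBoolFun (ι × κ) where
  dom := {x | ∃ h : ∀ i, block x i ∈ g.dom, (fun i => g.val ⟨block x i, h i⟩) ∈ f.dom}
  val x := f.val ⟨fun i => g.val ⟨block x.1 i, x.2.1 i⟩, x.2.2⟩

/-- The positions of the input bits of `f^d`: the set `ι ^ d`. -/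
def PowIdx (ι : Type) : ℕ → Type
  | 0 => Unit
  | 1 => ι
  | d + 2 => ι × PowIdx ι (d + 1)

/-- `ι ^ d` is finite if `ι` is. -/
instance instFintypePowIdx (ι : Type) [Fintype ι] : (d : ℕ) → Fintype (PowIdx ι d)
  | 0 => inferInstanceAs (Fintype Unit)
  | 1 => inferInstanceAs (Fintype ι)
  | d + 2 =>
    letI := instFintypePowIdx ι (d + 1)
    inferInstanceAs (Fintype (ι × PowIdx ι (d + 1)))

/-- `f` composed `d` times: `f^1 = f` and `f^d = f ∘ (f^(d-1), …, f^(d-1))` for `d ≥ 2`.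
(For `d = 0` the value is, by convention, the identity function on one bit.) -/
def pow {ι : Type} (f : PartialBoolFun ι) : (d : ℕ) → PartialBoolFun (PowIdx ι d)
  | 0 => ⟨Set.univ, fun x => x.1 ()⟩
  | 1 => f
  | d + 2 => f.comp (f.pow (d + 1))

/-- The filtering matrix `Δᵢ`, whose entry at `(x, y)` is `1` if `xᵢ ≠ yᵢ` and `0` otherwise. -/
def filterMatrix {ι : Type} (f : PartialBoolFun ι) (i : ι) : Matrix f.dom f.dom ℝ :=
  Matrix.of fun x y => if x.1 i = y.1 i then 0 else 1

open Classical in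
/-- The spectral norm of a real matrix with rows and columns indexed by the domain of `f`. -/
noncomputable def specNorm {ι : Type} [Fintype ι] (f : PartialBoolFun ι)
    (Γ : Matrix f.dom f.dom ℝ) : ℝ :=
  ‖Matrix.toEuclideanCLM (n := f.dom) (𝕜 := ℝ) Γ‖

/-- An adversary matrix for `f`: a real symmetric matrix indexed by the domain of `f`, with entries
of arbitrary sign, that vanishes at `(x, y)` whenever `f x = f y`. -/
structure IsAdversaryMatrix {ι : Type} (f : PartialBoolFun ι) (Γ : Matrix f.dom f.dom ℝ) :
    Prop where
  isSymm : Γ.IsSymm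
  eq_zero : ∀ x y, f.val x = f.val y → Γ x y = 0

/-- The values `‖Γ‖` of the adversary matrices `Γ` with `‖Γ ∘ Δᵢ‖ ≤ 1` for all `i` (entrywise
product). -/
def advValues {ι : Type} [Fintype ι] (f : PartialBoolFun ι) : Set ℝ :=
  {t | ∃ Γ : Matrix f.dom f.dom ℝ, f.IsAdversaryMatrix Γ ∧
    (∀ i, f.specNorm (Γ.hadamard (f.filterMatrix i)) ≤ 1) ∧ t = f.specNorm Γ}

/-- The general adversary bound
`ADV^±(f) = max {‖Γ‖ : Γ an adversary matrix for f with ‖Γ ∘ Δᵢ‖ ≤ 1 for all i}`. -/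
noncomputable def adv {ι : Type} [Fintype ι] (f : PartialBoolFun ι) : ℝ := sSup f.advValues

/-- An entry of a matrix is bounded by its spectral norm. -/
theorem abs_entry_le_specNorm {ι : Type} [Fintype ι] (f : PartialBoolFun ι)
    (Γ : Matrix f.dom f.dom ℝ) (x y : f.dom) : |Γ x y| ≤ f.specNorm Γ := by
  classical
  have h1 := (Matrix.toEuclideanCLM (n := f.dom) (𝕜 := ℝ) Γ).le_opNorm
    (EuclideanSpace.single y 1)
  have h2 := PiLp.norm_apply_le
    (Matrix.toEuclideanCLM (n := f.dom) (𝕜 := ℝ) Γ (EuclideanSpace.single y 1)) x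
  have h3 : (Matrix.toEuclideanCLM (n := f.dom) (𝕜 := ℝ) Γ (EuclideanSpace.single y 1)) x
      = Γ x y := by
    rw [Matrix.ofLp_toEuclideanCLM]
    simp
  rw [h3, Real.norm_eq_abs] at h2
  rw [PiLp.norm_single, norm_one, mul_one] at h1
  unfold specNorm
  convert h2.trans h1

/-- The feasible set is not empty: the zero matrix is feasible. -/
theorem zero_mem_advValues {ι : Type} [Fintype ι] (f : PartialBoolFun ι) :
    (0 : ℝ) ∈ f.advValues := by
  classical
  have h0 : f.specNorm 0 = 0 := by
    simp [specNorm]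
  refine ⟨0, ⟨Matrix.isSymm_zero, fun _ _ _ => rfl⟩, fun i => ?_, h0.symm⟩
  rw [Matrix.zero_hadamard, h0]
  exact zero_le_one

/-- The values are bounded, so that the supremum is a genuine one. -/
theorem bddAbove_advValues {ι : Type} [Fintype ι] (f : PartialBoolFun ι) :
    BddAbove f.advValues := by
  classical
  let K : Set (Matrix f.dom f.dom ℝ) := Set.univ.pi fun _ => Set.univ.pi fun _ => Set.Icc (-1) 1
  have hK : IsCompact K := isCompact_univ_pi fun _ => isCompact_univ_pi fun _ => isCompact_Icc
  have hc : Continuous fun Γ : Matrix f.dom f.dom ℝ => f.specNorm Γ :=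
    (LinearMap.continuous_of_finiteDimensional
      (Matrix.toEuclideanCLM (n := f.dom) (𝕜 := ℝ)).toAlgEquiv.toLinearMap).norm
  refine (hK.bddAbove_image hc.continuousOn).mono ?_
  rintro t ⟨Γ, hΓ, hb, rfl⟩
  refine ⟨Γ, fun x _ y _ => abs_le.1 ?_, rfl⟩
  by_cases hxy : x = y
  · subst hxy
    simp [hΓ.eq_zero x x rfl]
  · obtain ⟨i, hi⟩ : ∃ i, x.1 i ≠ y.1 i := by
      by_contra hcon
      push Not at hcon
      exact hxy (Subtype.ext (funext hcon))
    have := (f.abs_entry_le_specNorm (Γ.hadamard (f.filterMatrix i)) x y).trans (hb i)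
    simpa [Matrix.hadamard_apply, filterMatrix, hi] using this

end PartialBoolFun

/-!
The theorem follows by induction on `d` from supermultiplicativity of the adversary bound,
`ADV^±(f) * ADV^±(g) ≤ ADV^±(f ∘ (g, …, g))` (`PartialBoolFun.adv_mul_adv_le_adv_comp`).

Let `A` and `B` be feasible adversary matrices for `f` and `g`, with `B ≠ 0`, put `G = B / ‖B‖` and
write `x̃ = (g(xⁱ))ᵢ`. The adversary matrix used for `f ∘ (g, …, g)` is `‖B‖ • H` with
`H x y = A x̃ ỹ * ∏ i, (G + 1) xⁱ yⁱ`. It remains to see that `‖H‖ = ‖A‖` and that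
`‖B‖ • (H ∘ Δ_(p,q))` has norm at most `1`.

* Upper bounds (`Matrix.l2_opNorm_lift_le`). Let `G i` be symmetric, of norm at most `1`, and zero at
  pairs of inputs on which `g` agrees. Then `G i + 1` is positive semidefinite, hence a Gram matrix
  `(R i)ᴴ * R i`, and the matrix with entries `A x̃ ỹ * ∏ i, (G i + 1) xⁱ yⁱ` equals
  `Wᴴ * (A ⊗ₖ 1) * W`, where `W` sends the basis vector of `x` to `e_x̃ ⊗ ⨂ i, R i e_(xⁱ)`. As `g`
  agrees on `xⁱ` and `yⁱ` when `x̃ = ỹ`, the columns of `W` are orthonormal, so the norm is at most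
  `‖A‖`. This bounds `‖H‖`. It also bounds the filtered matrices: `‖B‖ • (H ∘ Δ_(p,q))` is of the
  same form, with `A ∘ Δ_p` in place of `A` and `B ∘ Δ_q` in place of `G` at position `p`
  (`PartialBoolFun.compMatrix_hadamard_filterMatrix`).
* Lower bound (`Matrix.l2_opNorm_le_lift`). Since `G` is off-diagonal with respect to the values of
  `g`, it has an eigenvector `u` of eigenvalue `1` whose restrictions to the two fibres of `g` are
  unit vectors (`Matrix.IsSymm.exists_balanced_vector`). The vectors `x ↦ [x̃ = s] ∏ i, u xⁱ` are
  orthonormal, and compressing `H` to their span gives back `A`, whence `‖A‖ ≤ ‖H‖`.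
-/

open scoped Matrix Matrix.Norms.L2Operator Kronecker

namespace Matrix

/-! ### The spectral norm of real matrices -/

theorem l2_opNorm_one_le {m : Type*} [Fintype m] [DecidableEq m] :
    ‖(1 : Matrix m m ℝ)‖ ≤ 1 := by
  rw [← diagonal_one, l2_opNorm_diagonal]
  exact (pi_norm_le_iff_of_nonneg zero_le_one).2 fun _ => by simp

theorem l2_opNorm_le_one_of_conjTranspose_mul_self {m n : Type*} [Fintype m] [Fintype n]
    [DecidableEq n] {W : Matrix m n ℝ} (h : Wᴴ * W = 1) : ‖W‖ ≤ 1 := by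
  have h1 := l2_opNorm_conjTranspose_mul_self W
  rw [h] at h1
  have h2 := l2_opNorm_one_le (m := n)
  nlinarith [norm_nonneg W]

theorem l2_opNorm_conjTranspose_mul_mul_le {m n : Type*} [Fintype m] [Fintype n]
    [DecidableEq m] [DecidableEq n] {W : Matrix m n ℝ} (h : Wᴴ * W = 1) (M : Matrix m m ℝ) :
    ‖Wᴴ * M * W‖ ≤ ‖M‖ := by
  have hW := l2_opNorm_le_one_of_conjTranspose_mul_self h
  have hW' : ‖Wᴴ‖ ≤ 1 := (l2_opNorm_conjTranspose W).trans_le hW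
  calc ‖Wᴴ * M * W‖ ≤ ‖Wᴴ * M‖ * ‖W‖ := l2_opNorm_mul _ _
    _ ≤ ‖Wᴴ * M‖ := mul_le_of_le_one_right (norm_nonneg _) hW
    _ ≤ ‖Wᴴ‖ * ‖M‖ := l2_opNorm_mul _ _
    _ ≤ ‖M‖ := mul_le_of_le_one_left (norm_nonneg _) hW'

theorem l2_opNorm_kronecker_one_le {m k : Type*} [Fintype m] [Fintype k] [DecidableEq m]
    [DecidableEq k] (A : Matrix m m ℝ) : ‖A ⊗ₖ (1 : Matrix k k ℝ)‖ ≤ ‖A‖ := by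
  rw [cstar_norm_def]
  refine ContinuousLinearMap.opNorm_le_bound _ (norm_nonneg _) fun v => ?_
  refine (sq_le_sq₀ (norm_nonneg _) (by positivity)).1 ?_
  have key : ∀ j : k, ∑ i, (∑ i', A i i' * v (i', j)) ^ 2 ≤ ‖A‖ ^ 2 * ∑ i, v (i, j) ^ 2 := by
    intro j
    have := A.l2_opNorm_mulVec (WithLp.toLp 2 fun i => v (i, j))
    have h2 := (sq_le_sq₀ (norm_nonneg _) (by positivity)).2 this
    rw [mul_pow, EuclideanSpace.norm_sq_eq, EuclideanSpace.norm_sq_eq] at h2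
    simpa [mulVec, dotProduct] using h2
  have happ : ∀ p : m × k, (toEuclideanCLM (n := m × k) (𝕜 := ℝ) (A ⊗ₖ (1 : Matrix k k ℝ)) v) p
      = ∑ i', A p.1 i' * v (i', p.2) := by
    intro p
    rw [ofLp_toEuclideanCLM]
    simp [mulVec, dotProduct, Fintype.sum_prod_type, one_apply]
  rw [mul_pow, EuclideanSpace.norm_sq_eq, EuclideanSpace.norm_sq_eq, Fintype.sum_prod_type_right,
    Fintype.sum_prod_type_right, Finset.mul_sum]
  refine Finset.sum_le_sum fun j _ => ?_
  simpa [happ] using key j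

/-! ### Positive semidefiniteness and eigenvectors -/

theorem posSemidef_add_one_of_norm_le_one {m : Type*} [Fintype m] [DecidableEq m]
    {G : Matrix m m ℝ} (hG : G.IsSymm) (h : ‖G‖ ≤ 1) : (G + 1).PosSemidef := by
  refine .of_dotProduct_mulVec_nonneg ?_ fun v => ?_
  · rw [IsHermitian, conjTranspose_eq_transpose_of_trivial, transpose_add, hG.eq, transpose_one]
  have h1 := G.l2_opNorm_mulVec (WithLp.toLp 2 v)
  have h2 := abs_real_inner_le_norm (WithLp.toLp 2 v) (WithLp.toLp 2 (G *ᵥ v))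
  have h3 : inner ℝ (WithLp.toLp 2 v) (WithLp.toLp 2 v) = v ⬝ᵥ v := by
    simp [PiLp.inner_apply, dotProduct, -inner_self_eq_norm_sq_to_K]
  have h4 : inner ℝ (WithLp.toLp 2 v) (WithLp.toLp 2 (G *ᵥ v)) = v ⬝ᵥ G *ᵥ v := by
    simp [PiLp.inner_apply, dotProduct, mul_comm]
  have h1' : ‖WithLp.toLp 2 (G *ᵥ v)‖ ≤ ‖G‖ * ‖WithLp.toLp 2 v‖ := h1
  rw [real_inner_self_eq_norm_sq] at h3
  rw [h4] at h2
  rw [add_mulVec, one_mulVec, star_trivial, dotProduct_add, ← h3]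
  have h5 := (abs_le.1 h2).1
  have h6 : ‖WithLp.toLp 2 (G *ᵥ v)‖ ≤ ‖WithLp.toLp 2 v‖ :=
    h1'.trans (mul_le_of_le_one_left (norm_nonneg _) h)
  nlinarith [norm_nonneg (WithLp.toLp 2 v)]

theorem PosSemidef.exists_eq_conjTranspose_mul_self {m : Type*} [Fintype m] [DecidableEq m]
    {M : Matrix m m ℝ} (hM : M.PosSemidef) : ∃ R : Matrix m m ℝ, M = Rᴴ * R := by
  open scoped MatrixOrder in
  exact CStarAlgebra.nonneg_iff_eq_star_mul_self.1 hM.nonneg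

theorem IsSymm.exists_mulVec_eq_smul_abs_eq_norm {m : Type*} [Fintype m] [DecidableEq m]
    {G : Matrix m m ℝ} (hG : G.IsSymm) (h0 : 0 < ‖G‖) :
    ∃ μ : ℝ, |μ| = ‖G‖ ∧ ∃ v ≠ 0, G *ᵥ v = μ • v := by
  have hsa : IsSelfAdjoint (toEuclideanCLM (n := m) (𝕜 := ℝ) G) := by
    have : IsSelfAdjoint G := by
      rw [isSelfAdjoint_iff, star_eq_conjTranspose, conjTranspose_eq_transpose_of_trivial, hG.eq]
    exact this.map _
  have hrad := ContinuousLinearMap.spectralRadius_eq_nnnorm _ hsa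
  have hspec : spectrum ℝ (toEuclideanCLM (n := m) (𝕜 := ℝ) G) = spectrum ℝ G :=
    AlgEquiv.spectrum_eq (toEuclideanCLM (n := m) (𝕜 := ℝ)) G
  have hne : (spectrum ℝ (toEuclideanCLM (n := m) (𝕜 := ℝ) G)).Nonempty := by
    by_contra hne
    rw [Set.not_nonempty_iff_eq_empty] at hne
    rw [spectralRadius, hne] at hrad
    have hz : ‖G‖₊ = 0 := by simpa [eq_comm, ← cstar_nnnorm_def] using hrad
    exact h0.ne' (congrArg NNReal.toReal hz)
  obtain ⟨μ, hμ, hμn⟩ := spectrum.exists_nnnorm_eq_spectralRadius_of_nonempty hne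
  rw [hrad] at hμn
  refine ⟨μ, ?_, ?_⟩
  · have := congrArg ENNReal.toReal hμn
    simpa [← cstar_norm_def] using this
  · rw [hspec, spectrum.mem_iff, isUnit_iff_isUnit_det, isUnit_iff_ne_zero, not_not,
      ← exists_mulVec_eq_zero_iff] at hμ
    obtain ⟨v, hv, hv'⟩ := hμ
    refine ⟨v, hv, ?_⟩
    rw [sub_mulVec, sub_eq_zero] at hv'
    rw [← hv', Algebra.algebraMap_eq_smul_one, smul_mulVec, one_mulVec]

/-- `G` vanishes at all pairs of indices on which `g` agrees, so that it is block off-diagonal for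
the partition of the indices into the two fibres of `g`. In particular its diagonal is zero. -/
def IsOffDiagonal {m : Type*} (g : m → Bool) (G : Matrix m m ℝ) : Prop :=
  ∀ c c', g c = g c' → G c c' = 0

/-- For a block off-diagonal matrix the norm itself, and not only its absolute value, is an
eigenvalue: changing the sign of an eigenvector on one fibre of `g` changes the sign of the
eigenvalue. -/
theorem IsSymm.exists_mulVec_eq_norm_smul {m : Type*} [Fintype m] [DecidableEq m]
    {G : Matrix m m ℝ} (hG : G.IsSymm) {g : m → Bool} (hg : G.IsOffDiagonal g) (h0 : 0 < ‖G‖) :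
    ∃ v ≠ 0, G *ᵥ v = ‖G‖ • v := by
  obtain ⟨μ, hμ, v, hv, hGv⟩ := hG.exists_mulVec_eq_smul_abs_eq_norm h0
  rcases abs_eq (norm_nonneg G) |>.1 hμ with h | h
  · exact ⟨v, hv, h ▸ hGv⟩
  · refine ⟨fun c => if g c then v c else -v c, fun h' => hv ?_, ?_⟩
    · ext c
      have := congrFun h' c
      by_cases hc : g c <;> simpa [hc] using this
    · ext c
      have h1 : ∑ c', G c c' * v c' = -‖G‖ * v c := by
        simpa [mulVec, dotProduct, h] using congrFun hGv c
      have h2 : (G *ᵥ fun c => if g c then v c else -v c) c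
          = (if g c then -1 else 1) * ∑ c', G c c' * v c' := by
        rw [mulVec, dotProduct, Finset.mul_sum]
        refine Finset.sum_congr rfl fun c' _ => ?_
        by_cases hcc : g c = g c'
        · simp [hg c c' hcc]
        · cases h3 : g c <;> cases h4 : g c' <;> simp_all
      rw [h2, h1]
      by_cases hc : g c <;> simp [hc]

/-- The eigenvector of eigenvalue `‖G‖`, scaled so that its restrictions `u₀`, `u₁` to the fibres
of `g` are unit vectors. The two have equal norm because `‖G‖ * ‖u₀‖² = ⟪u₀, G u₁⟫ = ‖G‖ * ‖u₁‖²`. On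
their span, `‖G‖⁻¹ • G + 1` acts as the all-ones `2 × 2` matrix. -/
theorem IsSymm.exists_balanced_vector {m : Type*} [Fintype m] [DecidableEq m]
    {G : Matrix m m ℝ} (hG : G.IsSymm) {g : m → Bool} (hg : G.IsOffDiagonal g) (h0 : 0 < ‖G‖) :
    ∃ u : m → ℝ, (∀ a, ∑ c with g c = a, u c * u c = 1) ∧
      ∀ a b, ∑ c with g c = a, ∑ c' with g c' = b, u c * (‖G‖⁻¹ • G + 1) c c' * u c' = 1 := by
  obtain ⟨v, hv, hGv⟩ := hG.exists_mulVec_eq_norm_smul hg h0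
  have hrow : ∀ c b, ∑ c' with g c' = b, G c c' * v c' = if g c = b then 0 else ‖G‖ * v c := by
    intro c b
    split_ifs with h
    · exact Finset.sum_eq_zero fun c' hc' => by
        rw [hg c c' (h.trans (Finset.mem_filter.1 hc').2.symm), zero_mul]
    · have h1 : ∑ c', G c c' * v c' = ‖G‖ * v c := by
        simpa [mulVec, dotProduct] using congrFun hGv c
      rw [← h1]
      refine Finset.sum_subset (Finset.filter_subset _ _) fun c' _ hc' => ?_
      rw [hg c c', zero_mul]
      simp only [Finset.mem_filter, Finset.mem_univ, true_and] at hc'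
      revert h hc'
      cases g c <;> cases g c' <;> cases b <;> simp
  -- The pairing of the two restrictions through `G`, computed from either side.
  have hcross : ∀ a b, a ≠ b → ∑ c with g c = a, ∑ c' with g c' = b, v c * (G c c' * v c')
      = ‖G‖ * ∑ c with g c = a, v c * v c := by
    intro a b hab
    rw [Finset.mul_sum]
    refine Finset.sum_congr rfl fun c hc => ?_
    rw [← Finset.mul_sum, hrow, if_neg (by rw [(Finset.mem_filter.1 hc).2]; exact hab)]
    ring
  have hbal : ∀ a b, ∑ c with g c = a, v c * v c = ∑ c with g c = b, v c * v c := by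
    intro a b
    by_cases hab : a = b
    · rw [hab]
    refine mul_left_cancel₀ h0.ne' ?_
    rw [← hcross a b hab, ← hcross b a (Ne.symm hab), Finset.sum_comm]
    refine Finset.sum_congr rfl fun c _ => Finset.sum_congr rfl fun c' _ => ?_
    rw [hG.apply c c']
    ring
  set N := ∑ c with g c = true, v c * v c with hN
  have hNpos : 0 < N := by
    have hnn : ∀ a, 0 ≤ ∑ c with g c = a, v c * v c :=
      fun a => Finset.sum_nonneg fun c _ => mul_self_nonneg _
    refine lt_of_le_of_ne (hnn _) fun hz => hv ?_
    ext c
    have h1 : ∑ c' with g c' = g c, v c' * v c' = 0 := (hbal _ _).trans hz.symm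
    have := (Finset.sum_eq_zero_iff_of_nonneg fun c' _ => mul_self_nonneg (v c')).1 h1 c (by simp)
    simpa using this
  have hs : √N * √N = N := Real.mul_self_sqrt hNpos.le
  have hs0 : √N ≠ 0 := (Real.sqrt_pos.2 hNpos).ne'
  have hone : ∀ a, ∑ c with g c = a, v c / √N * (v c / √N) = 1 := by
    intro a
    simp_rw [div_mul_div_comm, hs]
    rw [← Finset.sum_div, hbal a true, ← hN, div_self hNpos.ne']
  refine ⟨fun c => v c / √N, hone, fun a b => ?_⟩
  -- `‖G‖⁻¹ • G` contributes to this sum when `g c ≠ b` and the identity when `g c = b`.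
  have hinner : ∀ c, ∑ c' with g c' = b, v c / √N * (‖G‖⁻¹ • G + 1) c c' * (v c' / √N)
      = v c / √N * (v c / √N) := by
    intro c
    have : ∀ c', v c / √N * (‖G‖⁻¹ • G + 1) c c' * (v c' / √N)
        = v c / √N / √N * ‖G‖⁻¹ * (G c c' * v c')
          + v c / √N * (if c = c' then v c' / √N else 0) := by
      intro c'
      rw [add_apply, smul_apply, one_apply, smul_eq_mul]
      split_ifs <;> ring
    simp_rw [this]
    rw [Finset.sum_add_distrib, ← Finset.mul_sum, ← Finset.mul_sum, hrow, Finset.sum_ite_eq]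
    by_cases h : g c = b
    · simp [h]
    · simp [h]
      field_simp
  simp_rw [hinner]
  exact hone a

/-! ### Norms of matrices of product form -/

/-- Rows and columns are indexed by composed inputs `x`, with outer input `τ x` and blocks `β x i`.
Multiplying the lift of `A` entrywise by the Gram matrix `∏ i, (G i + 1)` does not increase the
norm, because composed inputs with the same outer input have orthonormal Gram vectors. -/
theorem l2_opNorm_lift_le {X S C ι : Type*} [Fintype X] [Fintype S] [Fintype C] [Fintype ι]
    [DecidableEq X] [DecidableEq S] [DecidableEq C]
    (τ : X → S) (β : X → ι → C) (g : C → Bool) (hβ : Function.Injective β)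
    (hτ : ∀ x y, τ x = τ y → ∀ i, g (β x i) = g (β y i))
    (A : Matrix S S ℝ) (G : ι → Matrix C C ℝ) (hsymm : ∀ i, (G i).IsSymm)
    (hoff : ∀ i, (G i).IsOffDiagonal g) (hnorm : ∀ i, ‖G i‖ ≤ 1) :
    ‖(of fun x y => A (τ x) (τ y) * ∏ i, (G i + 1) (β x i) (β y i) : Matrix X X ℝ)‖ ≤ ‖A‖ := by
  classical
  choose R hR using fun i =>
    (posSemidef_add_one_of_norm_le_one (hsymm i) (hnorm i)).exists_eq_conjTranspose_mul_self
  have hgram : ∀ x y, ∏ i, (G i + 1) (β x i) (β y i)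
      = ∑ k : ι → C, (∏ i, R i (k i) (β x i)) * ∏ i, R i (k i) (β y i) := by
    intro x y
    simp_rw [hR, mul_apply, conjTranspose_apply, star_trivial, ← Finset.prod_mul_distrib]
    rw [Fintype.prod_sum]
  -- `W x = e_(τ x) ⊗ ⨂ i, R i e_(β x i)`, with the tensor power of `C → ℝ` indexed by `ι → C`.
  let W : Matrix (S × (ι → C)) X ℝ := of fun p x =>
    if p.1 = τ x then ∏ i, R i (p.2 i) (β x i) else 0
  have hW : Wᴴ * W = 1 := by
    ext x y
    have : (Wᴴ * W) x y = if τ x = τ y then ∏ i, (G i + 1) (β x i) (β y i) else 0 := by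
      rw [hgram]
      by_cases hxy : τ x = τ y <;>
        simp [W, mul_apply, Fintype.sum_prod_type_right, hxy, eq_comm (a := τ y)]
    rw [this, one_apply]
    by_cases hxy : x = y
    · subst hxy
      simp [hoff _ _ _ rfl]
    rw [if_neg hxy]
    split_ifs with h
    · obtain ⟨i, hi⟩ : ∃ i, β x i ≠ β y i := by
        by_contra! hcon
        exact hxy (hβ (funext hcon))
      refine Finset.prod_eq_zero (Finset.mem_univ i) ?_
      rw [add_apply, hoff i _ _ (hτ x y h i), one_apply_ne hi, add_zero]
    · rfl
  have hH : (of fun x y => A (τ x) (τ y) * ∏ i, (G i + 1) (β x i) (β y i) : Matrix X X ℝ)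
      = Wᴴ * (A ⊗ₖ (1 : Matrix (ι → C) (ι → C) ℝ)) * W := by
    ext x y
    have hmul : ∀ p, ((A ⊗ₖ (1 : Matrix (ι → C) (ι → C) ℝ)) * W) p y
        = A p.1 (τ y) * ∏ i, R i (p.2 i) (β y i) := by
      intro p
      simp [W, mul_apply, Fintype.sum_prod_type, one_apply]
    rw [Matrix.mul_assoc, mul_apply, of_apply, hgram, Finset.mul_sum]
    simp only [hmul]
    simp [W, Fintype.sum_prod_type_right]
    exact Finset.sum_congr rfl fun k _ => by ring
  rw [hH]
  exact (l2_opNorm_conjTranspose_mul_mul_le hW _).trans (l2_opNorm_kronecker_one_le A)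

/-- The composed inputs over the outer input `s` are all choices, independently for each position
`i`, of a block on which `g` takes the value `σ s i`. Sums of products over them factor. -/
theorem sum_fiber_prod {X S C ι : Type*} [Fintype X] [Fintype C] [Fintype ι] [DecidableEq S]
    [DecidableEq ι]
    (τ : X → S) (β : X → ι → C) (g : C → Bool) (σ : S → ι → Bool) (hβ : Function.Injective β)
    (hσ : ∀ x i, σ (τ x) i = g (β x i))
    (hsurj : ∀ s (c : ι → C), (∀ i, g (c i) = σ s i) → ∃ x, τ x = s ∧ β x = c)
    (s : S) (F : ι → C → ℝ) :
    ∑ x with τ x = s, ∏ i, F i (β x i) = ∏ i, ∑ c with g c = σ s i, F i c := by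
  rw [Finset.prod_univ_sum]
  refine Finset.sum_bij (fun x _ => β x) ?_ (fun _ _ _ _ h => hβ h) ?_ (fun _ _ => rfl)
  · intro x hx
    simp only [Finset.mem_filter, Finset.mem_univ, true_and] at hx
    simp [Fintype.mem_piFinset, ← hx, hσ]
  · intro c hc
    simp only [Fintype.mem_piFinset, Finset.mem_filter, Finset.mem_univ, true_and] at hc
    obtain ⟨x, hx, hx'⟩ := hsurj s c hc
    exact ⟨x, by simpa using hx, hx'⟩

/-- `A` is recovered by compressing the product matrix to the span of the orthonormal vectors
`x ↦ [τ x = s] ∏ i, u (β x i)`, one for each outer input `s`. -/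
theorem l2_opNorm_le_lift {X S C ι : Type*} [Fintype X] [Fintype S] [Fintype C] [Fintype ι]
    [DecidableEq X] [DecidableEq S]
    (τ : X → S) (β : X → ι → C) (g : C → Bool) (σ : S → ι → Bool) (hβ : Function.Injective β)
    (hσ : ∀ x i, σ (τ x) i = g (β x i))
    (hsurj : ∀ s (c : ι → C), (∀ i, g (c i) = σ s i) → ∃ x, τ x = s ∧ β x = c)
    (A : Matrix S S ℝ) (K : Matrix C C ℝ) (u : C → ℝ)
    (hu : ∀ a, ∑ c with g c = a, u c * u c = 1)
    (hK : ∀ a b, ∑ c with g c = a, ∑ c' with g c' = b, u c * K c c' * u c' = 1) :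
    ‖A‖ ≤ ‖(of fun x y => A (τ x) (τ y) * ∏ i, K (β x i) (β y i) : Matrix X X ℝ)‖ := by
  classical
  let U : Matrix X S ℝ := of fun x s => if τ x = s then ∏ i, u (β x i) else 0
  have hU : Uᴴ * U = 1 := by
    ext s t
    have : (Uᴴ * U) s t = ∑ x with τ x = s, if s = t then ∏ i, u (β x i) * u (β x i) else 0 := by
      rw [mul_apply, Finset.sum_filter]
      refine Finset.sum_congr rfl fun x _ => ?_
      by_cases h : τ x = s <;> simp [U, h, Finset.prod_mul_distrib]
    rw [this, one_apply]
    split_ifs with h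
    · rw [sum_fiber_prod τ β g σ hβ hσ hsurj s fun _ c => u c * u c]
      simp [hu]
    · simp
  have hA : A = Uᴴ * (of fun x y => A (τ x) (τ y) * ∏ i, K (β x i) (β y i) : Matrix X X ℝ) * U := by
    ext s t
    have : (Uᴴ * (of fun x y => A (τ x) (τ y) * ∏ i, K (β x i) (β y i) : Matrix X X ℝ) * U) s t
        = A s t * ∑ x with τ x = s, ∑ y with τ y = t,
          ∏ i, u (β x i) * K (β x i) (β y i) * u (β y i) := by
      rw [Matrix.mul_assoc, mul_apply, Finset.mul_sum, Finset.sum_filter]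
      refine Finset.sum_congr rfl fun x _ => ?_
      rw [mul_apply, Finset.mul_sum, Finset.mul_sum, Finset.sum_filter]
      by_cases hx : τ x = s
      · rw [if_pos hx]
        refine Finset.sum_congr rfl fun y _ => ?_
        by_cases hy : τ y = t
        · simp [U, hx, hy, Finset.prod_mul_distrib]
          ring
        · simp [U, hy]
      · simp [U, hx]
    rw [this]
    have hin : ∀ x, ∑ y with τ y = t, ∏ i, u (β x i) * K (β x i) (β y i) * u (β y i)
        = ∏ i, ∑ c' with g c' = σ t i, u (β x i) * K (β x i) c' * u c' := fun x =>
      sum_fiber_prod τ β g σ hβ hσ hsurj t fun i c' => u (β x i) * K (β x i) c' * u c'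
    simp_rw [hin]
    rw [sum_fiber_prod τ β g σ hβ hσ hsurj s
      fun i c => ∑ c' with g c' = σ t i, u c * K c c' * u c']
    simp [hK]
  conv_lhs => rw [hA]
  exact l2_opNorm_conjTranspose_mul_mul_le hU _

end Matrix

namespace PartialBoolFun

/-! ### Inputs of a composed function -/

variable {ι κ : Type}

theorem specNorm_eq_norm [Fintype ι] (f : PartialBoolFun ι) [Fintype f.dom] [DecidableEq f.dom]
    (Γ : Matrix f.dom f.dom ℝ) : f.specNorm Γ = ‖Γ‖ := by
  rw [specNorm, Matrix.cstar_norm_def]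
  congr!

theorem specNorm_nonneg [Fintype ι] (f : PartialBoolFun ι) (Γ : Matrix f.dom f.dom ℝ) :
    0 ≤ f.specNorm Γ := by
  classical
  rw [specNorm_eq_norm]
  exact norm_nonneg Γ

theorem filterMatrix_isSymm (f : PartialBoolFun ι) (i : ι) : (f.filterMatrix i).IsSymm := by
  ext x y
  simp [filterMatrix, eq_comm]

theorem adv_nonneg [Fintype ι] (f : PartialBoolFun ι) : 0 ≤ f.adv :=
  le_csSup f.bddAbove_advValues f.zero_mem_advValues

/-- The block `xⁱ` of a valid input `x` of `f ∘ (g, …, g)`, as a valid input of `g`. -/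
def innerInput (f : PartialBoolFun ι) (g : PartialBoolFun κ) (x : (f.comp g).dom) (i : ι) :
    g.dom := ⟨block x.1 i, x.2.1 i⟩

/-- The string `(g(xⁱ))ᵢ` computed from a valid input `x` of `f ∘ (g, …, g)`, as a valid input
of `f`. -/
def outerInput (f : PartialBoolFun ι) (g : PartialBoolFun κ) (x : (f.comp g).dom) : f.dom :=
  ⟨fun i => g.val (f.innerInput g x i), x.2.2⟩

theorem innerInput_injective (f : PartialBoolFun ι) (g : PartialBoolFun κ) :
    Function.Injective (f.innerInput g) := fun _ _ h =>
  Subtype.ext <| funext fun p => congrFun (congrArg Subtype.val (congrFun h p.1)) p.2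

theorem exists_outerInput_eq_innerInput_eq (f : PartialBoolFun ι) (g : PartialBoolFun κ)
    (s : f.dom) (c : ι → g.dom) (h : ∀ i, g.val (c i) = s.1 i) :
    ∃ x, f.outerInput g x = s ∧ f.innerInput g x = c :=
  have hs : (fun i => g.val (c i)) = s.1 := funext h
  ⟨⟨fun p => (c p.1).1 p.2, fun i => (c i).2, show (fun i => g.val (c i)) ∈ f.dom from hs ▸ s.2⟩,
    Subtype.ext hs, rfl⟩

/-! ### The adversary matrix of a composition -/

/-- The matrix with entry `A x̃ ỹ * ∏ i, K i xⁱ yⁱ` at `(x, y)`, where `x̃ = (g(xⁱ))ᵢ`. -/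
noncomputable def compMatrix [Fintype ι] (f : PartialBoolFun ι) (g : PartialBoolFun κ)
    (A : Matrix f.dom f.dom ℝ) (K : ι → Matrix g.dom g.dom ℝ) :
    Matrix (f.comp g).dom (f.comp g).dom ℝ :=
  Matrix.of fun x y => A (f.outerInput g x) (f.outerInput g y) *
    ∏ i, K i (f.innerInput g x i) (f.innerInput g y i)

/-- Filtering by the bit `q` of block `p` filters `A` by `p` and turns the factor `r⁻¹ • B + 1` at
position `p` into `r⁻¹ • (B ∘ Δ_q)`. The scalar `r` cancels `r⁻¹`, and the identity may be put back
at position `p`, since `A ∘ Δ_p` vanishes where `xᵖ = yᵖ`. -/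
theorem compMatrix_hadamard_filterMatrix [Fintype ι] [DecidableEq ι]
    (f : PartialBoolFun ι) (g : PartialBoolFun κ) [DecidableEq g.dom] {A : Matrix f.dom f.dom ℝ}
    {B : Matrix g.dom g.dom ℝ} (hB : B.IsOffDiagonal g.val) {r : ℝ} (hr : r ≠ 0) (p : ι × κ) :
    (r • f.compMatrix g A fun _ => r⁻¹ • B + 1).hadamard ((f.comp g).filterMatrix p) =
      f.compMatrix g (A.hadamard (f.filterMatrix p.1)) fun i =>
        (if i = p.1 then B.hadamard (g.filterMatrix p.2) else r⁻¹ • B) + 1 := by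
  ext x y
  obtain ⟨p, q⟩ := p
  have hp : ((f.outerInput g x).1 p = (f.outerInput g y).1 p) ↔
    g.val (f.innerInput g x p) = g.val (f.innerInput g y p) := Iff.rfl
  have hq : (x.1 (p, q) = y.1 (p, q)) ↔
    (f.innerInput g x p).1 q = (f.innerInput g y p).1 q := Iff.rfl
  simp only [compMatrix, Matrix.hadamard_apply, Matrix.smul_apply, Matrix.of_apply, filterMatrix,
    hp, hq, smul_eq_mul]
  rw [← Finset.mul_prod_erase _ _ (Finset.mem_univ p), ← Finset.mul_prod_erase _ _
    (Finset.mem_univ p)]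
  have herase : ∏ i ∈ Finset.univ.erase p, ((if i = p then B.hadamard (g.filterMatrix q)
        else r⁻¹ • B) + 1) (f.innerInput g x i) (f.innerInput g y i)
      = ∏ i ∈ Finset.univ.erase p, (r⁻¹ • B + 1) (f.innerInput g x i) (f.innerInput g y i) :=
    Finset.prod_congr rfl fun i hi => by rw [if_neg (Finset.ne_of_mem_erase hi)]
  simp only [filterMatrix] at herase
  rw [herase]
  generalize (∏ i ∈ Finset.univ.erase p, (r⁻¹ • B + 1) (f.innerInput g x i) (f.innerInput g y i))
    = P
  generalize f.innerInput g x p = c, f.innerInput g y p = c'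
  simp only [Matrix.add_apply, Matrix.smul_apply, Matrix.hadamard_apply, Matrix.of_apply, if_true,
    smul_eq_mul]
  by_cases hcc : c = c'
  · simp [hcc]
  rw [Matrix.one_apply_ne hcc]
  by_cases hg : g.val c = g.val c'
  · simp [hg, hB c c' hg]
  · by_cases hbit : c.1 q = c'.1 q
    · simp [hbit]
    · simp [hg, hbit]
      field_simp

open Classical in
theorem mul_mem_advValues_comp [Fintype ι] [Fintype κ] (f : PartialBoolFun ι)
    (g : PartialBoolFun κ) {a b : ℝ} (ha : a ∈ f.advValues) (hb : b ∈ g.advValues) (hb0 : 0 < b) :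
    b * a ∈ (f.comp g).advValues := by
  obtain ⟨A, hA, hAΔ, rfl⟩ := ha
  obtain ⟨B, hB, hBΔ, rfl⟩ := hb
  simp only [specNorm_eq_norm] at hAΔ hBΔ hb0
  have hBoff : B.IsOffDiagonal g.val := hB.eq_zero
  have hcoord : ∀ x y, f.outerInput g x = f.outerInput g y →
      ∀ i, g.val (f.innerInput g x i) = g.val (f.innerInput g y i) :=
    fun x y h i => congrFun (congrArg Subtype.val h) i
  have hsymm : (‖B‖⁻¹ • B).IsSymm := hB.isSymm.smul _
  have hoff : (‖B‖⁻¹ • B).IsOffDiagonal g.val := fun c c' h => by simp [hBoff c c' h]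
  have hnorm : ‖‖B‖⁻¹ • B‖ = 1 := by
    rw [norm_smul, norm_inv, norm_norm, inv_mul_cancel₀ hb0.ne']
  obtain ⟨u, hu, hK⟩ := hB.isSymm.exists_balanced_vector hBoff hb0
  have hupper : ‖f.compMatrix g A fun _ => ‖B‖⁻¹ • B + 1‖ ≤ ‖A‖ :=
    Matrix.l2_opNorm_lift_le (f.outerInput g) (f.innerInput g) g.val (f.innerInput_injective g)
      hcoord A (fun _ => ‖B‖⁻¹ • B) (fun _ => hsymm) (fun _ => hoff) fun _ => hnorm.le
  have hlower : ‖A‖ ≤ ‖f.compMatrix g A fun _ => ‖B‖⁻¹ • B + 1‖ :=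
    Matrix.l2_opNorm_le_lift (f.outerInput g) (f.innerInput g) g.val (fun s => s.1)
      (f.innerInput_injective g) (fun _ _ => rfl) (f.exists_outerInput_eq_innerInput_eq g) A _ u
      hu hK
  refine ⟨‖B‖ • f.compMatrix g A fun _ => ‖B‖⁻¹ • B + 1, ⟨?_, ?_⟩, fun p => ?_, ?_⟩
  · ext x y
    have h1 : ∀ c c', (‖B‖⁻¹ • B + 1) c c' = (‖B‖⁻¹ • B + 1) c' c := fun c c' =>
      (hsymm.add Matrix.isSymm_one).apply c' c
    simp only [compMatrix, Matrix.transpose_apply, Matrix.smul_apply, Matrix.of_apply]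
    rw [hA.isSymm.apply (f.outerInput g x)]
    simp only [h1 (f.innerInput g y _)]
  · intro x y hxy
    have : A (f.outerInput g x) (f.outerInput g y) = 0 := hA.eq_zero _ _ hxy
    simp [compMatrix, this]
  · rw [compMatrix_hadamard_filterMatrix f g hBoff hb0.ne', specNorm_eq_norm]
    refine (Matrix.l2_opNorm_lift_le (f.outerInput g) (f.innerInput g) g.val
      (f.innerInput_injective g) hcoord _ _ (fun i => ?_) (fun i => ?_) fun i => ?_).trans
      (hAΔ p.1)
    · split_ifs
      · ext c c'
        simp only [Matrix.transpose_apply, Matrix.hadamard_apply, hB.isSymm.apply c c',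
          (g.filterMatrix_isSymm p.2).apply c c']
      · exact hsymm
    · split_ifs
      · exact fun c c' h => by simp [hBoff c c' h]
      · exact hoff
    · split_ifs
      · exact hBΔ p.2
      · exact hnorm.le
  · simp only [specNorm_eq_norm]
    rw [norm_smul, norm_norm, le_antisymm hupper hlower]

/-! ### Supermultiplicativity of the adversary bound -/

theorem adv_mul_adv_le_adv_comp [Fintype ι] [Fintype κ] (f : PartialBoolFun ι)
    (g : PartialBoolFun κ) : f.adv * g.adv ≤ (f.comp g).adv := by
  have hnn := (f.comp g).adv_nonneg
  have hmul : ∀ b ∈ g.advValues, ∀ a ∈ f.advValues, b * a ≤ (f.comp g).adv := by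
    intro b hb a ha
    have ha0 : 0 ≤ a := by
      obtain ⟨A, -, -, rfl⟩ := ha
      exact f.specNorm_nonneg A
    rcases le_or_gt b 0 with h | h
    · exact (mul_nonpos_of_nonpos_of_nonneg h ha0).trans hnn
    · exact le_csSup (f.comp g).bddAbove_advValues (f.mul_mem_advValues_comp g ha hb h)
  have hf : ∀ b ∈ g.advValues, f.adv * b ≤ (f.comp g).adv := by
    intro b hb
    rcases le_or_gt b 0 with h | h
    · exact (mul_nonpos_of_nonneg_of_nonpos f.adv_nonneg h).trans hnn
    · rw [← le_div_iff₀ h]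
      exact csSup_le ⟨0, f.zero_mem_advValues⟩ fun a ha =>
        (le_div_iff₀' h).2 (hmul b hb a ha)
  rcases f.adv_nonneg.eq_or_lt with h | h
  · rw [← h, zero_mul]
    exact hnn
  · rw [← le_div_iff₀' h]
    exact csSup_le ⟨0, g.zero_mem_advValues⟩ fun b hb => (le_div_iff₀' h).2 (hf b hb)

theorem adv_pow_le_adv_pow [Fintype ι] (f : PartialBoolFun ι) (d : ℕ) :
    f.adv ^ (d + 1) ≤ (f.pow (d + 1)).adv := by
  induction d with
  | zero => exact (pow_one f.adv).le
  | succ d ih =>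
    rw [pow_succ']
    exact (mul_le_mul_of_nonneg_left ih f.adv_nonneg).trans
      (f.adv_mul_adv_le_adv_comp (f.pow (d + 1)))

end PartialBoolFun

theorem lemma1 (n : ℕ) (S : Set (Fin n → Bool)) (f : S → Bool) (d : ℕ) (hd : 1 ≤ d) :
    (PartialBoolFun.adv ⟨S, f⟩) ^ d ≤ PartialBoolFun.adv (PartialBoolFun.pow ⟨S, f⟩ d) := by
  obtain ⟨d, rfl⟩ := Nat.exists_eq_add_of_le' hd
  exact PartialBoolFun.adv_pow_le_adv_pow _ d
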